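/- **Setting.** A source sends messages $\mathbf s_0,\mathbf s_1,\dots\in\mathbb F^{k}$ over $L_1\ge 1$ parallel links to a relay (first hop), and the relay sends packets over $L_2\ge1$ parallel links to a destination (second hop). At time $t$ the source encodes $\mathbf s_0,\dots,\mathbf s_t$ into one packet per link, the relay encodes the packets received at times $0,\dots,t$ into one packet per link, and the destination estimates $\mathbf s_t$ from what it received at times $0,\dots,t+T$. On link $i$ of hop $h$ at most $N^{(h)}_i$ packets are erased over the whole timeline (at arbitrary times). Assume $N^{(h)}_i\ge1$ and $$T\ge\max\bigl(\max_i N^{(1)}_i+\min_j N^{(2)}_j,\ \max_j N^{(2)}_j+\min_i N^{(1)}_i\bigr),$$ and let $\mathbb F$ be any field with at least $T$ elements. **Optimal spectrum.** For integers $N\ge 1$, $0\le k<n$ with $N\mid n-k$, put $w=\lceil \frac{Nn}{n-k}-1\rceil$ and let $G_{N,n,k}(d)$, the number of symbols with delay $d$, be $\frac{n-k}{N}$ for $N\le d<w$, $\;n-w\frac{n-k}{N}$ for $d=w\ge N$, and $0$ otherwise. **Parameters (OSWDF algorithm).** Choose one hop $B$ as the bottleneck; let $O$ be the other hop, and $m_B=\min_i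 N^{(B)}_i$, $m_O=\min_j N^{(O)}_j$, $D=T-m_B$. A *point of operation* is a packet length $n$ and numbers $k^{(B)}_i$ of symbols on the bottleneck links: either the initial one, $n=(T+1-m_O)(T+1-m_B)$, $k^{(B)}_i=\frac{T+1-m_O-N^{(B)}_i}{T+1-m_O}\,n$, or, in later iterations, any integers $n\ge 1$, $k_i^{(B)}\ge 0$ with $\frac{k^{(B)}_i}{n}\le\frac{T+1-m_O-N^{(B)}_i}{T+1-m_O}$ and $N^{(B)}_i\mid n-k^{(B)}_i$ for all $i$. Given a point of operation, put $c(d)=\sum_i G_{N^{(B)}_i,n,k^{(B)}_i}(T-d)$ for $0\le d\le T$ and $c(d)=0$ for $d>T$. Process the links $i$ of hop $O$ in decreasing order of $N_i^{(O)}$ (ties broken arbitrarily); for link $i$ with $N=N^{(O)}_i$: 1. set $k^{(O)}_i=\Bigl\lfloor\min_{N-1\le d\le D}\Bigl(n-nN\,\frac{1-\sum_{d<l\le D}c(l)/n}{d+1}\Bigr)\Bigr\rfloor$; 2. if $N\nmid n-k^{(O)}_i$, multiply $n$, $c$, all $k^{(B)}_l$, and all $k^{(O)}_l$ computed so far (including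 $k^{(O)}_i$) by $N$; 3. replace $c(d)$ by $c(d)-G_{N,n,k^{(O)}_i}(d)$ for all $d$ and then, for $d=0,1,2,\dots$ in turn, if $c(d)<0$, add $c(d)$ to $c(d+1)$ and set $c(d)=0$. Let $n,k^{(B)}_i,k^{(O)}_j$ be the final values and $k=\sum_j k^{(O)}_j$. **Theorem.** For either choice of the bottleneck hop, every point of operation, and every such order of the links, there is a code with these parameters, i.e. packet length $n$ on every link of both hops and $k$ source symbols per message, for which the destination recovers every $\mathbf s_t$ exactly at time $t+T$, for all messages and all admissible erasures. The code has the following structure. - *Link codes.* Link $i$ of hop $h$ carries a single-link code for $k^{(h)}_i$ symbols which, under $N^{(h)}_i$ erasures, recovers each symbol within its delay, exactly $G_{N^{(h)}_i,n,k^{(h)}_i}(d)$ of the symbols having delay $d$. Up to an ordering of message symbols and packet coordinates, it is a concatenation of diagonally interleaved systematic MDS codes with $N^{(h)}_i$ parity symbols each: in an $(m+N,m)$ block, symbol $p\in\{0,\dots,m-1\}$ of $\mathbf s_t$ is coordinate $p$ of the codeword whose $r$-th coordinate is sent at time $t-p+r$, and its delay is $m+N-1-p$. - *Separate coding.* In each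 hop the $k$ source symbols are placed injectively in the symbol positions of the links; every link encodes only its own symbols. Positions left free (they occur only in hop $B$) carry zeros, and are positions of largest delay. - *Symbol-wise decode-and-forward.* The relay decodes source symbol $j$ with its first-hop delay $T^{(1)}_j$ and uses $\mathbf s'_t[j]=\mathbf s_{t-T^{(1)}_j}[j]$ (zero for negative times) as symbol $j$ of its own message at time $t$; the destination decodes the relay's messages with delays $T^{(2)}_j$, and $T^{(1)}_j+T^{(2)}_j\le T$ for all $j$. -/

import Mathlib

/-! Streaming codes over a source - relay - destination network with several parallel erasure
links in each hop, symbol-wise decode-and-forward, separate coding, and the allocation algorithm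
of the optimized symbol-wise decode-and-forward scheme. -/

namespace MultiLinkRelay

/-! ### Erasure channels -/

/-- `e t = true` means that the packet sent at time `t` is erased; at most `N` packets are. -/
def IsErasureSequence (N : ℕ) (e : ℕ → Bool) : Prop :=
  {t | e t = true}.encard ≤ N

/-- The erasure channel: `none` is the erasure symbol. -/
def channel {α : Type*} (x : α) (e : Bool) : Option α :=
  if e = true then none else some x

/-! ### Streaming codes over the two-hop network -/

/-- An `(n₁, n₂, k, T)` streaming code over `F`: at time `t` the source encodes the messages
`s 0, …, s t`, the relay encodes the packets that it received at the times `0, …, t`, and the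
destination estimates `s t` from the packets that it received at the times `0, …, t + T`. -/
structure StreamingCode (F : Type*) {L₁ L₂ : ℕ} (n₁ : Fin L₁ → ℕ) (n₂ : Fin L₂ → ℕ)
    (k T : ℕ) where
  enc : ∀ t : ℕ, (Fin (t + 1) → Fin k → F) → ∀ i, Fin (n₁ i) → F
  relay : ∀ t : ℕ, (Fin (t + 1) → ∀ i, Option (Fin (n₁ i) → F)) → ∀ i, Fin (n₂ i) → F
  dec : ∀ t : ℕ, (Fin (t + T + 1) → ∀ i, Option (Fin (n₂ i) → F)) → Fin k → F

namespace StreamingCode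

variable {F : Type*} {L₁ L₂ : ℕ} {n₁ : Fin L₁ → ℕ} {n₂ : Fin L₂ → ℕ} {k T : ℕ}

/-- The packet received by the relay at time `t` on link `i` of the first hop. -/
def relayReceived (C : StreamingCode F n₁ n₂ k T) (s : ℕ → Fin k → F) (e₁ : Fin L₁ → ℕ → Bool)
    (t : ℕ) (i : Fin L₁) : Option (Fin (n₁ i) → F) :=
  channel (C.enc t (fun τ => s τ) i) (e₁ i t)

/-- The packet received by the destination at time `t` on link `i` of the second hop. -/
def destReceived (C : StreamingCode F n₁ n₂ k T) (s : ℕ → Fin k → F) (e₁ : Fin L₁ → ℕ → Bool)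
    (e₂ : Fin L₂ → ℕ → Bool) (t : ℕ) (i : Fin L₂) : Option (Fin (n₂ i) → F) :=
  channel (C.relay t (fun τ => C.relayReceived s e₁ τ) i) (e₂ i t)

/-- The estimate of `s t` that the destination forms at time `t + T`. -/
def estimate (C : StreamingCode F n₁ n₂ k T) (s : ℕ → Fin k → F) (e₁ : Fin L₁ → ℕ → Bool)
    (e₂ : Fin L₂ → ℕ → Bool) (t : ℕ) : Fin k → F :=
  C.dec t (fun τ => C.destReceived s e₁ e₂ τ)

/-- The destination recovers every source message with delay `T`, whatever the messages are and
whatever admissible erasures occur on the links of both hops. -/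
def IsAchievable (C : StreamingCode F n₁ n₂ k T) (N₁ : Fin L₁ → ℕ) (N₂ : Fin L₂ → ℕ) : Prop :=
  ∀ (s : ℕ → Fin k → F) (e₁ : Fin L₁ → ℕ → Bool) (e₂ : Fin L₂ → ℕ → Bool),
    (∀ i, IsErasureSequence (N₁ i) (e₁ i)) → (∀ i, IsErasureSequence (N₂ i) (e₂ i)) →
      ∀ t, C.estimate s e₁ e₂ t = s t

end StreamingCode

/-! ### Point-to-point codes and delay spectra -/

/-- A point-to-point code with links indexed by `ι` and message symbols indexed by `κ`, where
`n i` is the packet length on link `i` and `T j` the delay of the `j`-th symbol: the `j`-th symbol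
of the message of time `t` is estimated from the packets received at the times
`0, …, t + T j`. -/
structure PointToPointCode (F : Type*) {ι κ : Type} (n : ι → ℕ) (T : κ → ℕ) where
  enc : ∀ t : ℕ, (Fin (t + 1) → κ → F) → ∀ i, Fin (n i) → F
  dec : ∀ (j : κ) (t : ℕ), (Fin (t + T j + 1) → ∀ i, Option (Fin (n i) → F)) → F

/-- Single-link codes with packet length `n`. -/
abbrev SingleLinkCode (F : Type*) {κ : Type} (n : ℕ) (T : κ → ℕ) :=
  PointToPointCode F (fun _ : Unit => n) T

namespace PointToPointCode

variable {F : Type*} {ι κ : Type} {n : ι → ℕ} {T : κ → ℕ}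

def received (C : PointToPointCode F n T) (s : ℕ → κ → F) (e : ι → ℕ → Bool) (t : ℕ) (i : ι) :
    Option (Fin (n i) → F) :=
  channel (C.enc t (fun τ => s τ) i) (e i t)

/-- The code achieves its delay spectrum `T` under `N i` erasures on each link `i`. -/
def AchievesSpectrum (C : PointToPointCode F n T) (N : ι → ℕ) : Prop :=
  ∀ (s : ℕ → κ → F) (e : ι → ℕ → Bool), (∀ i, IsErasureSequence (N i) (e i)) →
    ∀ (j : κ) (t : ℕ), C.dec j t (fun τ => C.received s e τ) = s t j

/-- Separate coding: the message symbols are split among the links, and each link carries its own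
symbols by means of its own single-link code. -/
def separate {κ : ι → Type} {T : ∀ i, κ i → ℕ} (C : ∀ i, SingleLinkCode F (n i) (T i)) :
    PointToPointCode F n (fun x : Σ i, κ i => T x.1 x.2) where
  enc t s i := (C i).enc t (fun τ j => s τ ⟨i, j⟩) ()
  dec x t y := (C x.1).dec x.2 t (fun τ _ => y τ x.1)

/-- Relabeling of message symbols: symbol `j` is sent in position `p j` of the code `C`, and the
positions that are not used carry the trivial symbol `0`. -/
noncomputable def place [Zero F] {κ' : Type} (C : PointToPointCode F n T) (p : κ' ↪ κ) :
    PointToPointCode F n (fun j => T (p j)) where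
  enc t s := C.enc t (fun τ => Function.extend p (s τ) 0)
  dec j := C.dec (p j)

end PointToPointCode

/-- Symbol-wise decode-and-forward. The relay decodes symbol `j` of the source message of time `t`
at time `t + T₁ j` and uses it as symbol `j` of its own message of time `t + T₁ j`; symbols that
would refer to negative times are `0`. The destination decodes the relay's messages. -/
def symbolwiseDF {F : Type*} [Zero F] {L₁ L₂ : ℕ} {n₁ : Fin L₁ → ℕ} {n₂ : Fin L₂ → ℕ} {k : ℕ}
    {T₁ T₂ : Fin k → ℕ} (C₁ : PointToPointCode F n₁ T₁) (C₂ : PointToPointCode F n₂ T₂) (T : ℕ)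
    (hT : ∀ j, T₁ j + T₂ j ≤ T) : StreamingCode F n₁ n₂ k T where
  enc := C₁.enc
  relay t y := C₂.enc t fun τ j =>
    if h : T₁ j ≤ τ then
      C₁.dec j (τ - T₁ j) fun u => y ⟨u, by have := u.2; have := τ.2; omega⟩
    else 0
  dec t y j := C₂.dec j (t + T₁ j) fun u => y ⟨u, by have := u.2; have := hT j; omega⟩

/-! ### Diagonally interleaved MDS codes -/

/-- The systematic `(m + N, m)` block code with codewords `(u, u P)` is maximum distance separable:
its minimum distance is at least (hence exactly, if `m > 0`) `N + 1`. -/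
def IsMDS {F : Type*} [Field F] {m N : ℕ} (P : Matrix (Fin m) (Fin N) F) : Prop := by
  classical
  exact ∀ u : Fin m → F, u ≠ 0 → N + 1 ≤ hammingNorm (Sum.elim u (Matrix.vecMul u P))

/-- Diagonal interleaving of the systematic block code with parity part `P`: the codeword that
starts at time `a` occupies row `r` of the packet of time `a + r`. Thus row `p < m` at time `t`
carries `s t p`, and row `m + q` at time `t` carries the parity symbol `q` of the codeword that
starts at time `t - (m + q)`, whose information symbols are `s (t - (m + q) + p) p`
(with `0` for negative times). -/
def diagonalInterleaving {F : Type*} [Field F] {m N : ℕ} (P : Matrix (Fin m) (Fin N) F) (t : ℕ)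
    (s : Fin (t + 1) → Fin m → F) : Fin m ⊕ Fin N → F
  | Sum.inl p => s (Fin.last t) p
  | Sum.inr q => ∑ p : Fin m,
      if m + q ≤ t + p then s ⟨t + p - (m + q), by have := p.2; omega⟩ p * P p q else 0

/-- Up to an ordering of message symbols and packet coordinates, the single-link code `C` is a
concatenation of `r` diagonally interleaved systematic `(m b + N, m b)` MDS codes, `b < r`, and
symbol number `p` (counted from `0`) of such a code is decoded with delay `m b + N - 1 - p`. -/
def IsInterleavedMDSConcatenation {F : Type*} [Field F] {κ : Type} {n : ℕ} {T : κ → ℕ} (N : ℕ)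
    (C : SingleLinkCode F n T) : Prop :=
  ∃ (r : ℕ) (m : Fin r → ℕ) (P : ∀ b, Matrix (Fin (m b)) (Fin N) F)
    (σ : (Σ b, Fin (m b)) ≃ κ) (ρ : (Σ b, Fin (m b) ⊕ Fin N) ≃ Fin n),
    (∀ b, IsMDS (P b)) ∧
    (∀ b (p : Fin (m b)), T (σ ⟨b, p⟩) = m b + N - 1 - p) ∧
    ∀ (t : ℕ) (s : Fin (t + 1) → κ → F) (b : Fin r) (z : Fin (m b) ⊕ Fin N),
      C.enc t s () (ρ ⟨b, z⟩) =
        diagonalInterleaving (P b) t (fun τ p => s τ (σ ⟨b, p⟩)) z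

/-! ### The optimal delay spectrum of a single link -/

/-- The worst delay of an `(n, k)` single-link code under `N` erasures. -/
def worstDelay (N n k : ℕ) : ℕ :=
  ⌈((N : ℚ) * n / ((n : ℚ) - k) - 1 : ℚ)⌉₊

/-- The optimal delay spectrum for `N` erasures, packet length `n` and `k` symbols, as a list of
equally-delayed groups: the number of symbols with delay `d` is `(n - k) / N` for
`N ≤ d < worstDelay`, it is `n - worstDelay * (n - k) / N` for `d = worstDelay`, and `0` for all
other `d`. It is used only for `N ∣ n - k`. -/
def optimalSpectrum (N n k d : ℕ) : ℕ :=
  if d < N ∨ worstDelay N n k < d then 0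
  else if d = worstDelay N n k then n - worstDelay N n k * ((n - k) / N)
  else (n - k) / N

/-! ### The allocation algorithm

One hop is the bottleneck; `NB` and `NO` are the erasure vectors of the bottleneck and of the
other hop. -/

/-- A point of operation of the bottleneck hop: the common packet length `n` of all links, and the
number `k i` of symbols sent on link `i`. -/
structure OperatingPoint (L : ℕ) where
  n : ℕ
  k : Fin L → ℕ

/-- The starting point: `n = (T + 1 - min NO) (T + 1 - min NB)` and `k i = R i * n`, where
`R i = (T + 1 - min NO - NB i) / (T + 1 - min NO)`. -/
noncomputable def initialPoint (T : ℕ) {LB LO : ℕ} (NB : Fin LB → ℕ) (NO : Fin LO → ℕ) :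
    OperatingPoint LB where
  n := (T + 1 - ⨅ j, NO j) * (T + 1 - ⨅ i, NB i)
  k i := (T + 1 - (⨅ j, NO j) - NB i) * (T + 1 - ⨅ i, NB i)

/-- The points of operation among which the algorithm searches: the starting point, and every
point obtained by changing the rates `k i / n` of the bottleneck links, where the rate of link `i`
never exceeds `(T + 1 - min NO - NB i) / (T + 1 - min NO)` and `(n - k i) / NB i` is an
integer. -/
inductive IsPointOfOperation (T : ℕ) {LB LO : ℕ} (NB : Fin LB → ℕ) (NO : Fin LO → ℕ) :
    OperatingPoint LB → Prop
  | initial : IsPointOfOperation T NB NO (initialPoint T NB NO)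
  | adjusted (P : OperatingPoint LB) (hn : 0 < P.n)
      (hrate : ∀ i, (P.k i : ℚ) / P.n ≤
        ((T : ℚ) + 1 - (⨅ j, NO j : ℕ) - NB i) / ((T : ℚ) + 1 - (⨅ j, NO j : ℕ)))
      (hint : ∀ i, NB i ∣ P.n - P.k i) : IsPointOfOperation T NB NO P

/-- The state of the algorithm: the common packet length, the numbers of symbols allocated to the
links of the bottleneck and of the other hop, and, for each delay `d`, the number `con d` of
symbols that may still be sent with delay `d` in the other hop. -/
structure AllocState (LB LO : ℕ) where
  n : ℕ
  kB : Fin LB → ℕ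
  kO : Fin LO → ℕ
  con : ℕ → ℤ

/-- The initial constraint: as many symbols may be sent with delay `d` in the other hop as are sent
with delay `T - d` in the bottleneck. -/
def allocInit (T : ℕ) {LB LO : ℕ} (NB : Fin LB → ℕ) (P : OperatingPoint LB) :
    AllocState LB LO where
  n := P.n
  kB := P.k
  kO _ := 0
  con d := ∑ i, (optimalSpectrum (NB i) P.n (P.k i) (T - d) : ℤ)

/-- `rateCon D n con d` is the sum of `con l / n` over the delays `d < l ≤ D`. -/
def rateCon (D n : ℕ) (con : ℕ → ℤ) (d : ℕ) : ℚ :=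
  ∑ l ∈ Finset.Ioc d D, (con l : ℚ) / n

/-- The number of symbols allocated to a link with `N` erasures: the floor of the minimum of
`n - n N (1 - rateCon d) / (d + 1)` over the delays `d = D, D - 1, …, N - 1`. -/
def linkSymbols (D N n : ℕ) (con : ℕ → ℤ) : ℕ :=
  ⌊(Finset.range (D - N + 2)).inf' ⟨0, by simp⟩ fun j =>
    (n : ℚ) - n * N * ((1 - rateCon D n con (D - j)) / ((D - j : ℕ) + 1))⌋₊

/-- The (nonpositive) amount that is moved into delay `d` when negative entries of `v` are moved to
the next larger delay. -/
def carry (v : ℕ → ℤ) : ℕ → ℤ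
  | 0 => 0
  | d + 1 => min 0 (v d + carry v d)

/-- Removal of negative entries by moving them to the next larger delay. -/
def moveNegatives (v : ℕ → ℤ) (d : ℕ) : ℤ :=
  max 0 (v d + carry v d)

/-- One step of the algorithm, for link `i` of the other hop, where `D` is the largest delay
allowed: find the number `k` of symbols for this link; if `(n - k) / NO i` is not an integer,
multiply all parameters by `NO i`; subtract the optimal spectrum of this link from the constraint
and remove negative entries. -/
def allocStep (D : ℕ) {LB LO : ℕ} (NO : Fin LO → ℕ) (S : AllocState LB LO) (i : Fin LO) :
    AllocState LB LO :=
  let k := linkSymbols D (NO i) S.n S.con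
  let c := if NO i ∣ S.n - k then 1 else NO i
  { n := c * S.n
    kB := fun l => c * S.kB l
    kO := fun l => c * Function.update S.kO i k l
    con := moveNegatives fun d => c * S.con d - optimalSpectrum (NO i) (c * S.n) (c * k) d }

/-- The parameters computed from the point of operation `P` when the links of the other hop are
processed in the given order; the largest delay allowed in the other hop is `T - min NB`. -/
noncomputable def allocate (T : ℕ) {LB LO : ℕ} (NB : Fin LB → ℕ) (NO : Fin LO → ℕ)
    (P : OperatingPoint LB) (order : List (Fin LO)) : AllocState LB LO :=
  order.foldl (allocStep (T - ⨅ i, NB i) NO) (allocInit T NB P)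

/-- An enumeration of all links in decreasing order of the number of erasures. -/
def IsDecreasingOrder {L : ℕ} (N : Fin L → ℕ) (order : List (Fin L)) : Prop :=
  order.Nodup ∧ (∀ i, i ∈ order) ∧ order.Pairwise fun i j => N j ≤ N i

/-! ### The scheme -/

/-- One hop of the scheme, for `k` source symbols: packet length `n` on every link, single-link
codes for `kl i` symbols on link `i` that are concatenations of diagonally interleaved MDS codes
and achieve the optimal delay spectrum under `N i` erasures, and a placement of the source symbols
in the symbol positions of the links. If there are more positions than source symbols, the ones
left free (which carry zeros) are positions of largest delay. -/
structure HopDesign (F : Type*) [Field F] {L : ℕ} (N : Fin L → ℕ) (n k : ℕ)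
    (kl : Fin L → ℕ) where
  delay : ∀ i, Fin (kl i) → ℕ
  code : ∀ i, SingleLinkCode F n (delay i)
  position : Fin k ↪ Σ i, Fin (kl i)
  delay_card : ∀ i d, (Finset.univ.filter fun j => delay i j = d).card =
    optimalSpectrum (N i) n (kl i) d
  achieves : ∀ i, (code i).AchievesSpectrum fun _ => N i
  interleaved : ∀ i, IsInterleavedMDSConcatenation (N i) (code i)
  free_largest : ∀ x, x ∉ Set.range position →
    ∀ j, delay (position j).1 (position j).2 ≤ delay x.1 x.2

namespace HopDesign

variable {F : Type*} [Field F] {L : ℕ} {N : Fin L → ℕ} {n k : ℕ} {kl : Fin L → ℕ}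

/-- The delay of the `j`-th source symbol in this hop. -/
def symbolDelay (H : HopDesign F N n k kl) (j : Fin k) : ℕ :=
  H.delay (H.position j).1 (H.position j).2

/-- The multi-link code of the hop: separate coding on the links. -/
noncomputable def hopCode (H : HopDesign F N n k kl) :
    PointToPointCode F (fun _ : Fin L => n) H.symbolDelay :=
  (PointToPointCode.separate H.code).place H.position

end HopDesign

/-- There is a symbol-wise decode-and-forward code with separate coding on all links, with packet
length `n` on every link, `k₁ i` and `k₂ i` symbol positions on link `i` of the first and second
hop with the optimal delay spectra, and `k` source symbols per message, all of which the
destination recovers with delay `T`. -/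
def SchemeAchieves (F : Type*) [Field F] (T : ℕ) {L₁ L₂ : ℕ} (N₁ : Fin L₁ → ℕ) (N₂ : Fin L₂ → ℕ)
    (n k : ℕ) (k₁ : Fin L₁ → ℕ) (k₂ : Fin L₂ → ℕ) : Prop :=
  ∃ (H₁ : HopDesign F N₁ n k k₁) (H₂ : HopDesign F N₂ n k k₂)
    (hT : ∀ j, H₁.symbolDelay j + H₂.symbolDelay j ≤ T),
    (symbolwiseDF H₁.hopCode H₂.hopCode T hT).IsAchievable N₁ N₂

end MultiLinkRelay

/-! Each link distributes its `k` symbols evenly over `r = (n - k) / N` diagonally interleaved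
systematic Reed-Solomon codes with `N` parity symbols. A symbol of such a code is determined by its
diagonal once `N` further rows have been sent, because two codewords differing in that symbol
differ in more than `N` positions; counting the symbols of each delay gives the optimal spectrum,
whose tail sums from a delay `d ≥ N` on are `max 0 (n - d r)`.

The allocation keeps the following invariant: for every `d`, the tail sum from `d` on of the
remaining constraint plus the tail sums of the spectra already assigned is at most the tail sum of
the bottleneck spectrum mirrored at `T`. The number of symbols given to a link is chosen such that
its tail sums fit below those of the constraint, and moving negative entries to larger delays does
not increase a tail sum. At the end, for every `d`, there are at least as many bottleneck positions
of delay at most `T - d` as positions of delay at least `d` in the other hop. Sorting both hops and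
matching positions of equal rank therefore pairs delays with sum at most `T`, and leaves free only
bottleneck positions of largest delay. -/

namespace MultiLinkRelay

/-! ### Composition of codes -/

theorem symbolwiseDF_isAchievable {F : Type*} [Zero F] {L₁ L₂ : ℕ} {n₁ : Fin L₁ → ℕ}
    {n₂ : Fin L₂ → ℕ} {k : ℕ} {T₁ T₂ : Fin k → ℕ} {C₁ : PointToPointCode F n₁ T₁}
    {C₂ : PointToPointCode F n₂ T₂} {T : ℕ} (hT : ∀ j, T₁ j + T₂ j ≤ T) {N₁ : Fin L₁ → ℕ}
    {N₂ : Fin L₂ → ℕ} (h₁ : C₁.AchievesSpectrum N₁) (h₂ : C₂.AchievesSpectrum N₂) :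
    (symbolwiseDF C₁ C₂ T hT).IsAchievable N₁ N₂ := by
  intro s e₁ e₂ he₁ he₂ t
  funext j
  let s' : ℕ → Fin k → F := fun τ j => if T₁ j ≤ τ then s (τ - T₁ j) j else 0
  have relay_eq : ∀ τ i, (symbolwiseDF C₁ C₂ T hT).destReceived s e₁ e₂ τ i =
      C₂.received s' e₂ τ i := by
    intro τ i
    refine congrArg (fun x => channel (C₂.enc τ x i) (e₂ i τ)) (funext₂ fun τ' j' => ?_)
    exact dite_congr rfl (fun _ => h₁ s e₁ he₁ j' _) fun _ => rfl
  calc (symbolwiseDF C₁ C₂ T hT).estimate s e₁ e₂ t j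
      = C₂.dec j (t + T₁ j) (fun τ => C₂.received s' e₂ τ) :=
        congrArg (C₂.dec j (t + T₁ j)) (funext₂ fun τ i => relay_eq τ i)
    _ = s' (t + T₁ j) j := h₂ s' e₂ he₂ j (t + T₁ j)
    _ = s t j := by simp only [s', Nat.le_add_left, if_true, Nat.add_sub_cancel]

namespace PointToPointCode

variable {F : Type*} {ι κ : Type} {n : ι → ℕ} {T : κ → ℕ} {N : ι → ℕ}

theorem AchievesSpectrum.separate {κ : ι → Type} {T : ∀ i, κ i → ℕ}
    {C : ∀ i, SingleLinkCode F (n i) (T i)} (h : ∀ i, (C i).AchievesSpectrum fun _ => N i) :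
    (PointToPointCode.separate C).AchievesSpectrum N := fun s e he x t =>
  h x.1 (fun τ j => s τ ⟨x.1, j⟩) (fun _ => e x.1) (fun _ => he x.1) x.2 t

theorem AchievesSpectrum.place [Zero F] {C : PointToPointCode F n T} (h : C.AchievesSpectrum N)
    {κ' : Type} (p : κ' ↪ κ) : (C.place p).AchievesSpectrum N := fun s e he j t =>
  (h (fun τ => Function.extend p (s τ) 0) e he (p j) t).trans
    (p.injective.extend_apply (s t) 0 j)

theorem exists_dec_of_determined [Nonempty F]
    (enc : ∀ t : ℕ, (Fin (t + 1) → κ → F) → ∀ i, Fin (n i) → F)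
    (determined : ∀ (s s' : ℕ → κ → F) (e e' : ι → ℕ → Bool),
      (∀ i, IsErasureSequence (N i) (e i)) → ∀ (j : κ) (t : ℕ),
      (∀ τ ≤ t + T j, ∀ i, channel (enc τ (fun a => s a) i) (e i τ) =
        channel (enc τ (fun a => s' a) i) (e' i τ)) → s t j = s' t j) :
    ∃ C : PointToPointCode F n T, C.enc = enc ∧ C.AchievesSpectrum N := by
  classical
  let explains (j : κ) (t : ℕ) (y : Fin (t + T j + 1) → ∀ i, Option (Fin (n i) → F))
      (x : (ℕ → κ → F) × (ι → ℕ → Bool)) : Prop :=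
    (∀ i, IsErasureSequence (N i) (x.2 i)) ∧
      y = fun (τ : Fin (t + T j + 1)) i => channel (enc τ (fun a => x.1 a) i) (x.2 i τ)
  refine ⟨⟨enc, fun j t y => if hy : ∃ x, explains j t y x then hy.choose.1 t j
    else Classical.arbitrary F⟩, rfl, fun s e he j t => ?_⟩
  have hy : ∃ x, explains j t
      (fun (τ : Fin (t + T j + 1)) i => channel (enc τ (fun a => s a) i) (e i τ)) x :=
    ⟨(s, e), he, rfl⟩
  obtain ⟨admissible, received_eq⟩ := hy.choose_spec
  refine (dif_pos hy).trans (determined _ _ _ e admissible j t fun τ hτ i => ?_)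
  exact (congrFun₂ received_eq ⟨τ, Nat.lt_succ_of_le hτ⟩ i).symm

end PointToPointCode

/-! ### Systematic Reed-Solomon codes -/

section MDS

variable {F : Type*} [Field F] {m N : ℕ}

theorem card_le_hammingNorm_eval_add_natDegree {ι : Type*} [Fintype ι] [DecidableEq F]
    {f : Polynomial F} (hf : f ≠ 0) {a : ι → F} (ha : Function.Injective a) :
    Fintype.card ι ≤ hammingNorm (fun z => f.eval (a z)) + f.natDegree := by
  have card_zeros : (Finset.univ.filter fun z => f.eval (a z) = 0).card ≤ f.natDegree := by
    rw [← Finset.card_image_of_injective _ ha]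
    refine Polynomial.card_le_degree_of_subset_roots fun x hx => ?_
    obtain ⟨z, hz, rfl⟩ := Finset.mem_image.1 hx
    exact (Polynomial.mem_roots hf).2 (Finset.mem_filter.1 hz).2
  have split := Finset.card_filter_add_card_filter_not (s := (Finset.univ : Finset ι))
    (fun z => f.eval (a z) = 0)
  rw [Finset.card_univ] at split
  simp only [hammingNorm, ne_eq]
  omega

/-- The parity part of the systematic Reed-Solomon code with evaluation points `a`: the codeword of
`u` consists of the values at `a` of the polynomial of degree less than `m` that interpolates `u`
at the first `m` points. -/
noncomputable def reedSolomonParity (a : Fin m ⊕ Fin N → F) : Matrix (Fin m) (Fin N) F :=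
  Matrix.of fun p q =>
    (Lagrange.basis Finset.univ (fun p => a (Sum.inl p)) p).eval (a (Sum.inr q))

theorem elim_vecMul_reedSolomonParity {a : Fin m ⊕ Fin N → F} (ha : Function.Injective a)
    (u : Fin m → F) (z : Fin m ⊕ Fin N) :
    Sum.elim u (Matrix.vecMul u (reedSolomonParity a)) z =
      (Lagrange.interpolate Finset.univ (fun p => a (Sum.inl p)) u).eval (a z) := by
  rcases z with p | q
  · exact (Lagrange.eval_interpolate_at_node u (ha.comp Sum.inl_injective).injOn
      (Finset.mem_univ p)).symm
  · simp [reedSolomonParity, Lagrange.interpolate_apply, Matrix.vecMul, dotProduct,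
      Polynomial.eval_finsetSum]

theorem isMDS_reedSolomonParity {a : Fin m ⊕ Fin N → F} (ha : Function.Injective a) :
    IsMDS (reedSolomonParity a) := by
  classical
  intro u hu
  set f := Lagrange.interpolate Finset.univ (fun p => a (Sum.inl p)) u
  have codeword_eq : Sum.elim u (Matrix.vecMul u (reedSolomonParity a)) =
      fun z => f.eval (a z) := funext (elim_vecMul_reedSolomonParity ha u)
  have hf : f ≠ 0 := by
    intro hf
    refine hu (funext fun p => ?_)
    simpa [hf] using congrFun codeword_eq (Sum.inl p)
  have hdeg : f.natDegree < m := by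
    rw [← Nat.cast_lt (α := WithBot ℕ), ← Polynomial.degree_eq_natDegree hf]
    exact (Lagrange.degree_interpolate_lt u (ha.comp Sum.inl_injective).injOn).trans_eq (by simp)
  have hcard := card_le_hammingNorm_eval_add_natDegree hf ha
  rw [Fintype.card_sum, Fintype.card_fin, Fintype.card_fin] at hcard
  rw [codeword_eq]
  omega

theorem exists_isMDS (m : ℕ) {N : ℕ} (h : ((m + N : ℕ) : ℕ∞) ≤ ENat.card F) :
    ∃ P : Matrix (Fin m) (Fin N) F, IsMDS P := by
  obtain ⟨a, -⟩ := Fin.Embedding.exists_embedding_disjoint_range_of_add_le_ENat_card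
    (s := (∅ : Set F)) (n := m + N) (by simpa using h)
  exact ⟨reedSolomonParity (a ∘ finSumFinEquiv),
    isMDS_reedSolomonParity (a.injective.comp finSumFinEquiv.injective)⟩

theorem IsMDS.eq_zero {P : Matrix (Fin m) (Fin N) F} (hP : IsMDS P) {u : Fin m → F}
    {E : Set (Fin m ⊕ Fin N)} (hE : E.encard ≤ N)
    (hu : ∀ z ∉ E, Sum.elim u (Matrix.vecMul u P) z = 0) : u = 0 := by
  classical
  by_contra hne
  have weight_le : ((hammingNorm (Sum.elim u (Matrix.vecMul u P)) : ℕ) : ℕ∞) ≤ N := by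
    rw [hammingNorm, ← Set.encard_coe_eq_coe_finsetCard]
    refine (Set.encard_le_encard fun z hz => ?_).trans hE
    by_contra hzE
    exact (Finset.mem_filter.1 (Finset.mem_coe.1 hz)).2 (hu z hzE)
  exact absurd (hP u hne) (not_le.2 (Nat.lt_succ_of_le (by exact_mod_cast weight_le)))

end MDS

/-! ### Diagonal interleaving -/

section Diagonal

variable {F : Type*} [Field F] {m N : ℕ}

/-- The information symbols of the diagonal codeword through the symbol `s t p`, that is, of the
codeword that starts at time `t - p`; symbols of negative times are `0`. -/
def diagonalInfo (s : ℕ → Fin m → F) (t : ℕ) (p : Fin m) : Fin m → F := fun p' =>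
  if (p : ℕ) ≤ t + p' then s (t + p' - p) p' else 0

@[simp]
theorem diagonalInfo_self (s : ℕ → Fin m → F) (t : ℕ) (p : Fin m) :
    diagonalInfo s t p p = s t p := by
  simp [diagonalInfo]

theorem diagonalInterleaving_eq_codeword (P : Matrix (Fin m) (Fin N) F) (s : ℕ → Fin m → F)
    {t : ℕ} {p : Fin m} (z : Fin m ⊕ Fin N) (hz : (p : ℕ) ≤ t + finSumFinEquiv z) :
    diagonalInterleaving P (t + finSumFinEquiv z - p) (fun τ => s τ) z =
      Sum.elim (diagonalInfo s t p) (Matrix.vecMul (diagonalInfo s t p) P) z := by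
  rcases z with p' | q
  · simp only [finSumFinEquiv_apply_left, Fin.val_castAdd] at hz ⊢
    simp [diagonalInterleaving, diagonalInfo, hz]
  · simp only [finSumFinEquiv_apply_right, Fin.val_natAdd, diagonalInterleaving, Sum.elim_inr,
      Matrix.vecMul, dotProduct, diagonalInfo, ite_mul, zero_mul]
    refine Finset.sum_congr rfl fun p' _ => ?_
    have := p.isLt
    have start_iff : m + (q : ℕ) ≤ t + (m + q) - p + p' ↔ (p : ℕ) ≤ t + p' := by omega
    have time_eq : t + (m + (q : ℕ)) - p + p' - (m + q) = t + p' - p := by omega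
    simp only [start_iff, time_eq]

theorem diagonalInterleaving_unique {P : Matrix (Fin m) (Fin N) F} (hP : IsMDS P)
    (s s' : ℕ → Fin m → F) {e : ℕ → Bool} (he : IsErasureSequence N e) (t : ℕ) (p : Fin m)
    (h : ∀ τ ≤ t + (m + N - 1 - p), e τ = false →
      ∀ z, diagonalInterleaving P τ (fun a => s a) z =
        diagonalInterleaving P τ (fun a => s' a) z) :
    s t p = s' t p := by
  have hp := p.isLt
  let E : Set (Fin m ⊕ Fin N) :=
    {z | (p : ℕ) ≤ t + finSumFinEquiv z ∧ e (t + finSumFinEquiv z - p) = true}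
  have encard_E : E.encard ≤ N := by
    refine le_trans (Set.encard_le_encard_of_injOn (f := fun z => t + finSumFinEquiv z - p)
      (fun z hz => hz.2) fun x hx y hy hxy => ?_) he
    have hx := hx.1
    have hy := hy.1
    simp only at hxy
    exact finSumFinEquiv.injective (Fin.ext (by omega))
  let u := diagonalInfo s t p - diagonalInfo s' t p
  have hu : u = 0 := by
    refine hP.eq_zero encard_E fun z hz => ?_
    rcases lt_or_ge (t + (finSumFinEquiv z : ℕ)) p with hlt | hle
    · rcases z with p' | q
      · simp only [finSumFinEquiv_apply_left, Fin.val_castAdd] at hlt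
        simp [u, diagonalInfo, hlt.not_ge]
      · simp only [finSumFinEquiv_apply_right, Fin.val_natAdd] at hlt
        omega
    · have hlt := (finSumFinEquiv z).isLt
      have unerased : e (t + finSumFinEquiv z - p) = false := by
        simpa [E, hle] using hz
      have heq := h _ (by omega) unerased z
      rw [diagonalInterleaving_eq_codeword P s z hle, diagonalInterleaving_eq_codeword P s' z hle,
        ← sub_eq_zero] at heq
      rcases z with p' | q <;> simpa [u, Matrix.sub_vecMul] using heq
  simpa [u, sub_eq_zero] using congrFun hu p

end Diagonal

/-! ### The optimal delay spectrum -/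

/-- Packet length `n` and number of symbols `k` for which `N` divides `n - k` and the optimal
spectrum for `N` erasures vanishes from delay `M` on: the worst delay is at most `M - 1`, which is
written here without division, as `N * n ≤ M * (n - k)`. -/
structure IsLinkParameter (M N n k : ℕ) : Prop where
  lt : k < n
  dvd : N ∣ n - k
  le : N * n ≤ M * (n - k)

section Spectrum

variable {M N n k r : ℕ}

theorem worstDelay_bounds (hN : 0 < N) (hr : 0 < r) (hn : n = k + N * r) :
    worstDelay N n k * r < n ∧ n ≤ (worstDelay N n k + 1) * r := by
  have hrq : (0 : ℚ) < r := by exact_mod_cast hr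
  have hNq : (1 : ℚ) ≤ N := by exact_mod_cast hN
  have quotient_eq : ((N : ℚ) * n / ((n : ℚ) - k) - 1 : ℚ) = n / r - 1 := by
    have : (n : ℚ) - k = N * r := by rw [hn]; push_cast; ring
    rw [this, mul_div_mul_left _ _ (by positivity)]
  have quotient_nonneg : (0 : ℚ) ≤ n / r - 1 := by
    rw [sub_nonneg, one_le_div hrq, hn]
    push_cast
    nlinarith [(Nat.cast_nonneg k : (0 : ℚ) ≤ k)]
  rw [worstDelay, quotient_eq]
  constructor
  · have := Nat.ceil_lt_add_one quotient_nonneg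
    rw [sub_add_cancel, lt_div_iff₀ hrq] at this
    exact_mod_cast this
  · have := Nat.le_ceil ((n : ℚ) / r - 1)
    rw [sub_le_iff_le_add, div_le_iff₀ hrq] at this
    exact_mod_cast this

theorem exists_eq_add_mul_of_dvd_sub (hk : k < n) (hdvd : N ∣ n - k) :
    ∃ r, 0 < N ∧ 0 < r ∧ (n - k) / N = r ∧ n = k + N * r := by
  obtain ⟨r, hr⟩ := hdvd
  have hpos : 0 < N * r := by omega
  have hN := Nat.pos_of_mul_pos_right hpos
  exact ⟨r, hN, Nat.pos_of_mul_pos_left hpos, by rw [hr, Nat.mul_div_cancel_left _ hN], by omega⟩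

theorem optimalSpectrum_eq (hk : k < n) (hdvd : N ∣ n - k) (d : ℕ) :
    optimalSpectrum N n k d =
      if d < N then 0 else min ((n - k) / N) (n - d * ((n - k) / N)) := by
  obtain ⟨r, hN, hr, hdiv, hn⟩ := exists_eq_add_mul_of_dvd_sub hk hdvd
  obtain ⟨worst_lt, le_worst⟩ := worstDelay_bounds hN hr hn
  rw [optimalSpectrum, hdiv]
  generalize worstDelay N n k = w at worst_lt le_worst
  by_cases hd : d < N
  · simp only [hd, true_or, if_true]
  simp only [hd, false_or, if_false]
  rcases lt_trichotomy w d with hwd | rfl | hwd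
  · have : (w + 1) * r ≤ d * r := Nat.mul_le_mul_right r hwd
    rw [if_pos hwd, Nat.sub_eq_zero_of_le (le_worst.trans this), Nat.min_zero]
  · rw [if_neg (lt_irrefl _), if_pos rfl, min_eq_right]
    rw [add_mul, one_mul] at le_worst
    omega
  · have : (d + 1) * r ≤ w * r := Nat.mul_le_mul_right r hwd
    rw [add_mul, one_mul] at this
    rw [if_neg hwd.not_gt, if_neg hwd.ne, min_eq_left]
    omega

theorem optimalSpectrum_mul (hk : k < n) (hdvd : N ∣ n - k) {c : ℕ} (hc : 0 < c) (d : ℕ) :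
    optimalSpectrum N (c * n) (c * k) d = c * optimalSpectrum N n k d := by
  have hdvd' : N ∣ c * n - c * k := Nat.mul_sub c n k ▸ hdvd.mul_left c
  rw [optimalSpectrum_eq hk hdvd, optimalSpectrum_eq (Nat.mul_lt_mul_of_pos_left hk hc) hdvd',
    ← Nat.mul_sub, Nat.mul_div_assoc _ hdvd]
  split_ifs
  · rw [mul_zero]
  · rw [Nat.mul_left_comm d, ← Nat.mul_sub, Nat.mul_min_mul_left]

namespace IsLinkParameter

theorem mul (h : IsLinkParameter M N n k) {c : ℕ} (hc : 0 < c) :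
    IsLinkParameter M N (c * n) (c * k) where
  lt := Nat.mul_lt_mul_of_pos_left h.lt hc
  dvd := Nat.mul_sub c n k ▸ h.dvd.mul_left c
  le := calc
    N * (c * n) = c * (N * n) := by ring
    _ ≤ c * (M * (n - k)) := Nat.mul_le_mul_left c h.le
    _ = M * (c * n - c * k) := by rw [← Nat.mul_sub]; ring

theorem le_mul_div (h : IsLinkParameter M N n k) : n ≤ M * ((n - k) / N) := by
  obtain ⟨r, hN, -, hdiv, hn⟩ := exists_eq_add_mul_of_dvd_sub h.lt h.dvd
  refine Nat.le_of_mul_le_mul_left (h.le.trans_eq ?_) hN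
  rw [hdiv, hn, Nat.add_sub_cancel_left, Nat.mul_left_comm]

theorem optimalSpectrum_eq_zero (h : IsLinkParameter M N n k) {d : ℕ} (hd : M ≤ d) :
    optimalSpectrum N n k d = 0 := by
  have hle : n ≤ d * ((n - k) / N) := h.le_mul_div.trans (Nat.mul_le_mul_right _ hd)
  rw [optimalSpectrum_eq h.lt h.dvd, Nat.sub_eq_zero_of_le hle, Nat.min_zero, ite_self]

theorem sum_Ico_optimalSpectrum (h : IsLinkParameter M N n k) {d : ℕ} (hNd : N ≤ d)
    (hdM : d ≤ M) :
    ∑ l ∈ Finset.Ico d M, optimalSpectrum N n k l = n - d * ((n - k) / N) := by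
  induction hdM using Nat.decreasingInduction with
  | self => rw [Finset.Ico_self, Finset.sum_empty, Nat.sub_eq_zero_of_le h.le_mul_div]
  | of_succ d hdM ih =>
    rw [Finset.sum_eq_sum_Ico_succ_bot hdM, ih (Nat.le_succ_of_le hNd),
      optimalSpectrum_eq h.lt h.dvd, if_neg hNd.not_gt, add_mul, one_mul]
    generalize (n - k) / N = r
    omega

end IsLinkParameter

end Spectrum

/-! ### Even distribution of the symbols over the diagonal blocks -/

section BlockSize

variable {k r : ℕ}

/-- The size of block `b` when `k` symbols are distributed evenly over `r` blocks, the first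
`k % r` of which get one symbol more than the others. -/
def blockSize (k r b : ℕ) : ℕ :=
  k / r + if b < k % r then 1 else 0

theorem lt_blockSize_iff {b : ℕ} (hb : b < r) (d : ℕ) : d < blockSize k r b ↔ d * r + b < k := by
  have hdiv := Nat.div_add_mod' k r
  have hmod := Nat.mod_lt k (b.zero_le.trans_lt hb)
  rw [blockSize]
  rcases lt_trichotomy d (k / r) with hd | rfl | hd
  · have : (d + 1) * r ≤ k / r * r := Nat.mul_le_mul_right r hd
    rw [add_mul, one_mul] at this
    split_ifs <;> omega
  · split_ifs <;> omega
  · have : (k / r + 1) * r ≤ d * r := Nat.mul_le_mul_right r hd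
    rw [add_mul, one_mul] at this
    split_ifs <;> omega

theorem card_filter_lt_blockSize (d : ℕ) :
    (Finset.univ.filter fun b : Fin r => d < blockSize k r b).card = min r (k - d * r) := by
  rw [← Fin.card_filter_val_lt]
  congr 1
  ext b
  simp only [Finset.mem_filter, Finset.mem_univ, true_and, lt_blockSize_iff b.isLt]
  omega

theorem sum_blockSize (hr : 0 < r) : ∑ b : Fin r, blockSize k r b = k := by
  have hmod := (Nat.mod_lt k hr).le
  simp only [blockSize, Finset.sum_add_distrib, Finset.sum_const, Finset.card_univ,
    Fintype.card_fin, smul_eq_mul, ← Finset.card_filter, Fin.card_filter_val_lt,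
    min_eq_right hmod]
  exact Nat.div_add_mod k r

theorem blockSize_add_le {M N n b : ℕ} (hn : n = k + N * r) (hM : n ≤ M * r) (hb : b < r) :
    blockSize k r b + N ≤ M := by
  have hNM : N ≤ M := Nat.le_of_mul_le_mul_right (by omega) (b.zero_le.trans_lt hb)
  have hk : k ≤ (M - N) * r := by rw [Nat.sub_mul]; omega
  have : ¬ M - N < blockSize k r b := by rw [lt_blockSize_iff hb]; omega
  omega

theorem sum_boole_lt_blockSize_add {N n : ℕ} (hn : n = k + N * r) (d : ℕ) :
    (∑ b : Fin r, if N ≤ d ∧ d < blockSize k r b + N then 1 else 0) =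
      if d < N then 0 else min r (n - d * r) := by
  split_ifs with hd
  · simp only [hd.not_ge, false_and, if_false, Finset.sum_const_zero]
  · have hNd := not_lt.1 hd
    rw [← Finset.card_filter, ← Nat.sub_add_cancel hNd, add_mul, hn, Nat.add_sub_add_right,
      ← card_filter_lt_blockSize]
    simp only [Nat.le_add_left, true_and, Nat.add_lt_add_iff_right]

end BlockSize

theorem card_filter_sigma {ι : Type*} [Fintype ι] {κ : ι → Type*} [∀ i, Fintype (κ i)]
    (p : (Σ i, κ i) → Prop) [DecidablePred p] :
    (Finset.univ.filter p).card = ∑ i, (Finset.univ.filter fun j => p ⟨i, j⟩).card := by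
  simp only [Finset.card_filter, Fintype.sum_sigma]

theorem card_filter_blockDelay (m N d : ℕ) :
    (Finset.univ.filter fun p : Fin m => m + N - 1 - p = d).card =
      if N ≤ d ∧ d < m + N then 1 else 0 := by
  split_ifs with hd
  · refine Finset.card_eq_one.2 ⟨⟨m + N - 1 - d, by omega⟩, Finset.ext fun p => ?_⟩
    simp only [Finset.mem_filter, Finset.mem_univ, true_and, Finset.mem_singleton, Fin.ext_iff]
    omega
  · rw [Finset.card_eq_zero, Finset.filter_eq_empty_iff]
    intro p _
    omega

/-! ### Link codes with the optimal spectrum -/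

section LinkCode

variable {F : Type*} [Field F]

theorem exists_interleavedCode {κ : Type} {n N r : ℕ} {m : Fin r → ℕ}
    {P : ∀ b, Matrix (Fin (m b)) (Fin N) F} (hP : ∀ b, IsMDS (P b))
    (σ : (Σ b, Fin (m b)) ≃ κ) (ρ : (Σ b, Fin (m b) ⊕ Fin N) ≃ Fin n) {T : κ → ℕ}
    (hT : ∀ b (p : Fin (m b)), T (σ ⟨b, p⟩) = m b + N - 1 - p) :
    ∃ C : SingleLinkCode F n T,
      C.AchievesSpectrum (fun _ => N) ∧ IsInterleavedMDSConcatenation N C := by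
  let enc : ∀ t : ℕ, (Fin (t + 1) → κ → F) → ∀ _ : Unit, Fin n → F := fun t s _ x =>
    diagonalInterleaving (P (ρ.symm x).1) t (fun τ p => s τ (σ ⟨(ρ.symm x).1, p⟩)) (ρ.symm x).2
  have enc_eq (t : ℕ) (s : Fin (t + 1) → κ → F) (b : Fin r) (z : Fin (m b) ⊕ Fin N) :
      enc t s () (ρ ⟨b, z⟩) = diagonalInterleaving (P b) t (fun τ p => s τ (σ ⟨b, p⟩)) z :=
    congrArg (fun x : Σ b : Fin r, Fin (m b) ⊕ Fin N =>
      diagonalInterleaving (P x.1) t (fun τ p => s τ (σ ⟨x.1, p⟩)) x.2)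
      (ρ.symm_apply_apply ⟨b, z⟩)
  obtain ⟨C, code_eq, achieves⟩ := PointToPointCode.exists_dec_of_determined (T := T)
      (N := fun _ => N) enc <| by
    intro s s' e e' he j t received_eq
    obtain ⟨⟨b, p⟩, rfl⟩ := σ.surjective j
    refine diagonalInterleaving_unique (hP b) (fun τ p => s τ (σ ⟨b, p⟩))
      (fun τ p => s' τ (σ ⟨b, p⟩)) (he ()) t p fun τ hτ unerased z => ?_
    have packet_eq := received_eq τ (by rwa [hT]) ()
    simp only [channel, unerased, Bool.false_eq_true, if_false] at packet_eq
    split_ifs at packet_eq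
    have := congrFun (Option.some.inj packet_eq) (ρ ⟨b, z⟩)
    rwa [enc_eq, enc_eq] at this
  exact ⟨C, achieves, r, m, P, σ, ρ, hP, hT, fun t s b z => by rw [code_eq, enc_eq]⟩

/-- The data that one link contributes to a `HopDesign`: a single-link code for `k` symbols in
packets of length `n` that achieves the optimal spectrum under `N` erasures. -/
structure LinkDesign (F : Type*) [Field F] (N n k : ℕ) where
  delay : Fin k → ℕ
  code : SingleLinkCode F n delay
  delay_card : ∀ d, (Finset.univ.filter fun j => delay j = d).card = optimalSpectrum N n k d
  achieves : code.AchievesSpectrum fun _ => N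
  interleaved : IsInterleavedMDSConcatenation N code

theorem IsLinkParameter.nonempty_linkDesign {M N n k : ℕ} (h : IsLinkParameter M N n k)
    (hM : (M : ℕ∞) ≤ ENat.card F) : Nonempty (LinkDesign F N n k) := by
  obtain ⟨r, -, hr, hdiv, hn⟩ := exists_eq_add_mul_of_dvd_sub h.lt h.dvd
  let m : Fin r → ℕ := fun b => blockSize k r b
  choose P hP using fun b => exists_isMDS (F := F) (m b)
    ((Nat.cast_le.2 (blockSize_add_le hn (hdiv ▸ h.le_mul_div) b.isLt)).trans hM)
  let σ : (Σ b, Fin (m b)) ≃ Fin k := Fintype.equivFinOfCardEq (by simp [m, sum_blockSize hr])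
  let ρ : (Σ b, Fin (m b) ⊕ Fin N) ≃ Fin n := Fintype.equivFinOfCardEq (by
    simp [m, Finset.sum_add_distrib, sum_blockSize hr, hn, Nat.mul_comm])
  let delay : Fin k → ℕ := fun j => m (σ.symm j).1 + N - 1 - (σ.symm j).2
  have delay_eq (b : Fin r) (p : Fin (m b)) : delay (σ ⟨b, p⟩) = m b + N - 1 - p :=
    congrArg (fun x : Σ b : Fin r, Fin (m b) => m x.1 + N - 1 - x.2) (σ.symm_apply_apply ⟨b, p⟩)
  obtain ⟨code, achieves, interleaved⟩ := exists_interleavedCode hP σ ρ delay_eq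
  refine ⟨⟨delay, code, fun d => ?_, achieves, interleaved⟩⟩
  calc (Finset.univ.filter fun j => delay j = d).card
      = (Finset.univ.filter fun x : Σ b, Fin (m b) => m x.1 + N - 1 - x.2 = d).card :=
        Finset.card_equiv σ.symm fun j => by simp [delay]
    _ = ∑ b, if N ≤ d ∧ d < m b + N then 1 else 0 := by
        simp only [card_filter_sigma, card_filter_blockDelay]
    _ = if d < N then 0 else min r (n - d * r) := sum_boole_lt_blockSize_add hn d
    _ = optimalSpectrum N n k d := by rw [optimalSpectrum_eq h.lt h.dvd, hdiv]

end LinkCode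

/-! ### Moving negative entries to larger delays -/

section MoveNegatives

variable {v : ℕ → ℤ} {d e : ℕ}

theorem carry_nonpos (v : ℕ → ℤ) : ∀ d, carry v d ≤ 0
  | 0 => le_rfl
  | _ + 1 => min_le_left _ _

theorem moveNegatives_add_carry_succ (v : ℕ → ℤ) (d : ℕ) :
    moveNegatives v d + carry v (d + 1) = v d + carry v d := by
  rw [moveNegatives, carry, add_comm, min_add_max, zero_add]

theorem sum_Ico_moveNegatives_add_carry (v : ℕ → ℤ) (hde : d ≤ e) :
    ∑ l ∈ Finset.Ico d e, moveNegatives v l + carry v e =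
      ∑ l ∈ Finset.Ico d e, v l + carry v d := by
  induction e, hde using Nat.le_induction with
  | base => simp only [Finset.Ico_self, Finset.sum_empty]
  | succ e hde ih =>
    rw [Finset.sum_Ico_succ_top hde, Finset.sum_Ico_succ_top hde]
    linarith [moveNegatives_add_carry_succ v e]

theorem carry_add_sum_Ico_nonneg (hv : ∀ d, 0 ≤ ∑ l ∈ Finset.Ico d e, v l) (hde : d ≤ e) :
    0 ≤ carry v d + ∑ l ∈ Finset.Ico d e, v l := by
  induction d with
  | zero => simpa only [carry, zero_add] using hv 0
  | succ d ih =>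
    have prev := ih (Nat.le_of_succ_le hde)
    rw [Finset.sum_eq_sum_Ico_succ_bot hde, ← add_assoc, add_comm (carry v d)] at prev
    rw [carry, min_add, zero_add]
    exact le_min (hv (d + 1)) prev

theorem sum_Ico_moveNegatives_le (hv : ∀ d, 0 ≤ ∑ l ∈ Finset.Ico d e, v l) (d : ℕ) :
    ∑ l ∈ Finset.Ico d e, moveNegatives v l ≤ ∑ l ∈ Finset.Ico d e, v l := by
  rcases le_or_gt d e with hde | hed
  · have carry_nonneg := carry_add_sum_Ico_nonneg hv le_rfl
    rw [Finset.Ico_self, Finset.sum_empty, add_zero] at carry_nonneg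
    linarith [sum_Ico_moveNegatives_add_carry v hde, carry_nonpos v d]
  · simp only [Finset.Ico_eq_empty_of_le hed.le, Finset.sum_empty, le_refl]

end MoveNegatives

/-! ### The number of symbols allocated to a link -/

section LinkSymbols

variable {D N n k : ℕ} {con : ℕ → ℤ}

theorem rateCon_eq (D n : ℕ) (con : ℕ → ℤ) (d : ℕ) :
    rateCon D n con d = ((∑ l ∈ Finset.Ico (d + 1) (D + 1), con l : ℤ) : ℚ) / n := by
  rw [rateCon, Int.cast_sum, Finset.sum_div]
  exact Finset.sum_congr (by ext l; simp only [Finset.mem_Ioc, Finset.mem_Ico]; omega)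
    fun _ _ => rfl

theorem rateCon_nonneg (hcon : ∀ d, 0 ≤ con d) (d : ℕ) : 0 ≤ rateCon D n con d :=
  Finset.sum_nonneg fun l _ => div_nonneg (Int.cast_nonneg (hcon l)) n.cast_nonneg

theorem linkSymbols_term_nonneg (hcon : ∀ d, 0 ≤ con d) {d : ℕ} (hd : N ≤ d + 1) :
    (0 : ℚ) ≤ n - n * N * ((1 - rateCon D n con d) / (d + 1)) := by
  have hdq : (N : ℚ) ≤ d + 1 := by exact_mod_cast hd
  have rate_le : N * ((1 - rateCon D n con d) / (d + 1)) ≤ 1 := by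
    rw [← mul_div_assoc, div_le_one (by positivity)]
    nlinarith [rateCon_nonneg (D := D) (n := n) hcon d, (N.cast_nonneg : (0 : ℚ) ≤ N)]
  rw [sub_nonneg, mul_assoc]
  exact mul_le_of_le_one_right n.cast_nonneg rate_le

theorem linkSymbols_le (hND : N ≤ D) (hcon : ∀ d, 0 ≤ con d) {d : ℕ} (hNd : N ≤ d + 1)
    (hdD : d ≤ D) :
    (linkSymbols D N n con : ℚ) ≤ n - n * N * ((1 - rateCon D n con d) / (d + 1)) := by
  refine (Nat.floor_le (Finset.le_inf' _ _ fun j hj => ?_)).trans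
    ((Finset.inf'_le _ (Finset.mem_range.2 (by omega : D - d < D - N + 2))).trans_eq ?_)
  · have := Finset.mem_range.1 hj
    exact linkSymbols_term_nonneg hcon (by omega)
  · rw [Nat.sub_sub_self hdD]

/-- The tail sums of the optimal spectrum of a link with `k` symbols, which are
`n - d * ((n - k) / N)` from any delay `d ≥ N` on, do not exceed the tail sums of `con` up to the
delay `D`. The inequality is multiplied by `N` to avoid the division; its case `d = D + 1` says
that no delay exceeds `D`. -/
def FitsConstraint (D N n k : ℕ) (con : ℕ → ℤ) : Prop :=
  ∀ d, N ≤ d → d ≤ D + 1 →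
    (N : ℤ) * n ≤ d * ((n : ℤ) - k) + N * ∑ l ∈ Finset.Ico d (D + 1), con l

theorem fitsConstraint_linkSymbols (hN : 0 < N) (hND : N ≤ D) (hn : 0 < n)
    (hcon : ∀ d, 0 ≤ con d) : FitsConstraint D N n (linkSymbols D N n con) con := by
  rintro (_ | d) hNd hdD
  · exact absurd hN hNd.not_gt
  have hnq : (n : ℚ) ≠ 0 := by exact_mod_cast hn.ne'
  have symbols_le := linkSymbols_le (n := n) hND hcon hNd (Nat.le_of_succ_le_succ hdD)
  rw [rateCon_eq] at symbols_le
  generalize ∑ l ∈ Finset.Ico (d + 1) (D + 1), con l = tail at symbols_le ⊢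
  have cancel_n : (n : ℚ) * N * ((1 - tail / n) / (d + 1)) = N * (n - tail) / (d + 1) := by
    field_simp
  rw [cancel_n, le_sub_comm, div_le_iff₀ (by positivity)] at symbols_le
  have : (N : ℚ) * n ≤ (d + 1 : ℕ) * (n - linkSymbols D N n con) + N * tail := by
    push_cast
    linarith
  exact_mod_cast this

namespace FitsConstraint

theorem mul (h : FitsConstraint D N n k con) (c : ℕ) :
    FitsConstraint D N (c * n) (c * k) fun d => c * con d := by
  intro d hNd hdD
  have := mul_le_mul_of_nonneg_left (h d hNd hdD) (Nat.cast_nonneg (α := ℤ) c)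
  rw [← Finset.mul_sum]
  push_cast
  linarith

theorem lt_and_le (h : FitsConstraint D N n k con) (hN : 0 < N) (hND : N ≤ D) (hn : 0 < n) :
    k < n ∧ N * n ≤ (D + 1) * (n - k) := by
  have last := h (D + 1) (Nat.le_succ_of_le hND) le_rfl
  rw [Finset.Ico_self, Finset.sum_empty, mul_zero, add_zero] at last
  have hlt : k < n := by
    have : (0 : ℤ) < N * n := by positivity
    have := pos_of_mul_pos_right (this.trans_le last) (Nat.cast_nonneg _)
    omega
  refine ⟨hlt, ?_⟩
  zify [hlt.le]
  exact_mod_cast last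

theorem sum_Ico_optimalSpectrum_le_of_le (h : FitsConstraint D N n k con)
    (hlink : IsLinkParameter (D + 1) N n k) (hcon : ∀ d, 0 ≤ con d) {d : ℕ} (hNd : N ≤ d)
    (hdD : d ≤ D + 1) :
    ∑ l ∈ Finset.Ico d (D + 1), (optimalSpectrum N n k l : ℤ) ≤
      ∑ l ∈ Finset.Ico d (D + 1), con l := by
  obtain ⟨r, hN, -, hdiv, hn⟩ := exists_eq_add_mul_of_dvd_sub hlink.lt hlink.dvd
  have hNz : (0 : ℤ) < N := by exact_mod_cast hN
  have tail_nonneg : 0 ≤ ∑ l ∈ Finset.Ico d (D + 1), con l := Finset.sum_nonneg fun l _ => hcon l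
  have fits := h d hNd hdD
  rw [← Nat.cast_sum, hlink.sum_Ico_optimalSpectrum hNd hdD, hdiv]
  generalize ∑ l ∈ Finset.Ico d (D + 1), con l = tail at tail_nonneg fits ⊢
  have hnk : (n : ℤ) - k = N * r := by rw [hn]; push_cast; ring
  have : (n : ℤ) ≤ (d * r : ℕ) + tail := by
    rw [hnk, mul_left_comm, ← mul_add] at fits
    exact_mod_cast le_of_mul_le_mul_left fits hNz
  omega

theorem sum_Ico_optimalSpectrum_le (h : FitsConstraint D N n k con)
    (hlink : IsLinkParameter (D + 1) N n k) (hND : N ≤ D) (hcon : ∀ d, 0 ≤ con d) (d : ℕ) :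
    ∑ l ∈ Finset.Ico d (D + 1), (optimalSpectrum N n k l : ℤ) ≤
      ∑ l ∈ Finset.Ico d (D + 1), con l := by
  rcases le_or_gt d (D + 1) with hdD | hdD
  · rcases le_or_gt N d with hNd | hdN
    · exact h.sum_Ico_optimalSpectrum_le_of_le hlink hcon hNd hdD
    · have hND' := Nat.le_succ_of_le hND
      rw [← Finset.sum_Ico_consecutive _ hdN.le hND', ← Finset.sum_Ico_consecutive con hdN.le hND']
      refine add_le_add (Finset.sum_le_sum fun l hl => ?_)
        (h.sum_Ico_optimalSpectrum_le_of_le hlink hcon le_rfl hND')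
      rw [optimalSpectrum_eq hlink.lt hlink.dvd, if_pos (Finset.mem_Ico.1 hl).2]
      exact hcon l
  · simp only [Finset.Ico_eq_empty_of_le hdD.le, Finset.sum_empty, le_refl]

end FitsConstraint

end LinkSymbols

/-! ### The allocation algorithm -/

namespace AllocState

variable {LB LO : ℕ}

/-- Multiplication of all parameters of the allocation by `c`. -/
def scale (c : ℕ) (S : AllocState LB LO) : AllocState LB LO where
  n := c * S.n
  kB l := c * S.kB l
  kO l := c * S.kO l
  con d := c * S.con d

/-- Assignment of `k` symbols to link `i` of the other hop, whose optimal spectrum is removed from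
the constraint. -/
def assign (NO : Fin LO → ℕ) (S : AllocState LB LO) (i : Fin LO) (k : ℕ) : AllocState LB LO where
  n := S.n
  kB := S.kB
  kO := Function.update S.kO i k
  con := moveNegatives fun d => S.con d - optimalSpectrum (NO i) S.n k d

end AllocState

theorem allocStep_eq {LB LO : ℕ} (D : ℕ) (NO : Fin LO → ℕ) (S : AllocState LB LO) (i : Fin LO) :
    allocStep D NO S i =
      (S.scale (if NO i ∣ S.n - linkSymbols D (NO i) S.n S.con then 1 else NO i)).assign NO i
        ((if NO i ∣ S.n - linkSymbols D (NO i) S.n S.con then 1 else NO i) *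
          linkSymbols D (NO i) S.n S.con) := by
  simp only [allocStep, AllocState.scale, AllocState.assign, AllocState.mk.injEq, true_and,
    and_true]
  funext l
  exact Function.apply_update (fun _ x => _ * x) S.kO i _ l

/-- The invariant of the allocation algorithm after the links in `done` have been processed: all
links have valid parameters, with delays less than `M` in the bottleneck and at most `D` in the
other hop, and the tail sums of the remaining constraint and of the spectra assigned so far are
together at most those of the bottleneck spectrum mirrored at `T`. -/
structure AllocInvariant (T D M : ℕ) {LB LO : ℕ} (NB : Fin LB → ℕ) (NO : Fin LO → ℕ)
    (done : Finset (Fin LO)) (S : AllocState LB LO) : Prop where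
  n_pos : 0 < S.n
  bottleneck : ∀ i, IsLinkParameter M (NB i) S.n (S.kB i)
  other : ∀ i ∈ done, IsLinkParameter (D + 1) (NO i) S.n (S.kO i)
  con_nonneg : ∀ d, 0 ≤ S.con d
  sum_le : ∀ d, ∑ l ∈ Finset.Ico d (D + 1), S.con l +
    ∑ i ∈ done, ∑ l ∈ Finset.Ico d (D + 1), (optimalSpectrum (NO i) S.n (S.kO i) l : ℤ) ≤
      ∑ l ∈ Finset.Ico d (D + 1), ∑ i, (optimalSpectrum (NB i) S.n (S.kB i) (T - l) : ℤ)

namespace AllocInvariant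

variable {T D M LB LO : ℕ} {NB : Fin LB → ℕ} {NO : Fin LO → ℕ} {done : Finset (Fin LO)}
  {S : AllocState LB LO}

theorem scale (h : AllocInvariant T D M NB NO done S) {c : ℕ} (hc : 0 < c) :
    AllocInvariant T D M NB NO done (S.scale c) where
  n_pos := Nat.mul_pos hc h.n_pos
  bottleneck i := (h.bottleneck i).mul hc
  other i hi := (h.other i hi).mul hc
  con_nonneg d := mul_nonneg c.cast_nonneg (h.con_nonneg d)
  sum_le d := by
    have other_eq (i) (hi : i ∈ done) (l : ℕ) :
        (optimalSpectrum (NO i) (c * S.n) (c * S.kO i) l : ℤ) =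
          c * optimalSpectrum (NO i) S.n (S.kO i) l := by
      exact_mod_cast optimalSpectrum_mul (h.other i hi).lt (h.other i hi).dvd hc l
    have bottleneck_eq (i) (l : ℕ) :
        (optimalSpectrum (NB i) (c * S.n) (c * S.kB i) l : ℤ) =
          c * optimalSpectrum (NB i) S.n (S.kB i) l := by
      exact_mod_cast optimalSpectrum_mul (h.bottleneck i).lt (h.bottleneck i).dvd hc l
    simp only [AllocState.scale, bottleneck_eq]
    rw [Finset.sum_congr rfl fun i hi => Finset.sum_congr rfl fun l _ => other_eq i hi l]
    simp only [← Finset.mul_sum, ← mul_add]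
    exact mul_le_mul_of_nonneg_left (h.sum_le d) c.cast_nonneg

theorem assign (h : AllocInvariant T D M NB NO done S) {i : Fin LO} (hi : i ∉ done) {k : ℕ}
    (hk : IsLinkParameter (D + 1) (NO i) S.n k)
    (hle : ∀ d, ∑ l ∈ Finset.Ico d (D + 1), (optimalSpectrum (NO i) S.n k l : ℤ) ≤
      ∑ l ∈ Finset.Ico d (D + 1), S.con l) :
    AllocInvariant T D M NB NO (insert i done) (S.assign NO i k) := by
  have update_eq (j) (hj : j ∈ done) : Function.update S.kO i k j = S.kO j :=
    Function.update_of_ne (ne_of_mem_of_not_mem hj hi) _ _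
  refine ⟨h.n_pos, h.bottleneck, fun j hj => ?_, fun d => le_max_left _ _, fun d => ?_⟩
  · rcases Finset.mem_insert.1 hj with rfl | hj
    · simpa only [AllocState.assign, Function.update_self] using hk
    · simpa only [AllocState.assign, update_eq j hj] using h.other j hj
  · have moved_le := sum_Ico_moveNegatives_le (e := D + 1)
      (v := fun l => S.con l - (optimalSpectrum (NO i) S.n k l : ℤ))
      (fun d => by rw [Finset.sum_sub_distrib]; exact sub_nonneg.2 (hle d)) d
    rw [Finset.sum_sub_distrib] at moved_le
    simp only [AllocState.assign, Finset.sum_insert hi, Function.update_self]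
    rw [Finset.sum_congr (s₁ := done) rfl fun j hj => by rw [update_eq j hj]]
    linarith [h.sum_le d]

theorem step (h : AllocInvariant T D M NB NO done S) {i : Fin LO} (hi : i ∉ done)
    (hN : 0 < NO i) (hND : NO i ≤ D) :
    AllocInvariant T D M NB NO (insert i done) (allocStep D NO S i) := by
  rw [allocStep_eq]
  have fits := fitsConstraint_linkSymbols hN hND h.n_pos h.con_nonneg
  generalize linkSymbols D (NO i) S.n S.con = k at fits ⊢
  generalize hc : (if NO i ∣ S.n - k then 1 else NO i) = c
  have hc_pos : 0 < c := by split_ifs at hc <;> omega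
  have hdvd : NO i ∣ c * S.n - c * k := by
    rw [← Nat.mul_sub, ← hc]
    split_ifs with hdvd
    · rwa [one_mul]
    · exact dvd_mul_right _ _
  have hscale := h.scale hc_pos
  obtain ⟨hlt, hle⟩ := (fits.mul c).lt_and_le hN hND hscale.n_pos
  have hlink : IsLinkParameter (D + 1) (NO i) (c * S.n) (c * k) := ⟨hlt, hdvd, hle⟩
  exact hscale.assign hi hlink
    ((fits.mul c).sum_Ico_optimalSpectrum_le hlink hND hscale.con_nonneg)

theorem foldl (hNO : ∀ i, 0 < NO i) (hD : ∀ i, NO i ≤ D)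
    (h : AllocInvariant T D M NB NO ∅ S) {order : List (Fin LO)} (horder : order.Nodup) :
    AllocInvariant T D M NB NO order.toFinset (order.foldl (allocStep D NO) S) := by
  induction order using List.reverseRecOn with
  | nil => exact h
  | append_singleton order i ih =>
    obtain ⟨hi, hnodup⟩ := (List.nodup_concat order i).1 (List.concat_eq_append ▸ horder)
    have hinsert : (order ++ [i]).toFinset = insert i order.toFinset := by
      ext j
      simp
    rw [List.foldl_append, hinsert]
    exact (ih hnodup).step (mt List.mem_toFinset.1 hi) (hNO i) (hD i)

end AllocInvariant

theorem isLinkParameter_of_rate_le {A N n k : ℕ} (hN : 0 < N) (hn : 0 < n) (hA : 0 < A)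
    (hrate : (k : ℚ) / n ≤ ((A : ℚ) - N) / A) (hdvd : N ∣ n - k) : IsLinkParameter A N n k := by
  rw [div_le_div_iff₀ (by exact_mod_cast hn) (by exact_mod_cast hA)] at hrate
  have hmul : (k : ℤ) * A ≤ (A - N) * n := by exact_mod_cast hrate
  have hlt : k < n := by
    have : (0 : ℤ) < N * n := by positivity
    exact_mod_cast lt_of_mul_lt_mul_right (by linarith : (k : ℤ) * A < n * A) A.cast_nonneg
  refine ⟨hlt, hdvd, ?_⟩
  zify [hlt.le]
  linarith

theorem isLinkParameter_sub_mul {A B N : ℕ} (hN : 0 < N) (hNA : N ≤ A) (hB : 0 < B) :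
    IsLinkParameter A N (A * B) ((A - N) * B) := by
  have hsub : A * B - (A - N) * B = N * B := by rw [← Nat.sub_mul, Nat.sub_sub_self hNA]
  refine ⟨Nat.mul_lt_mul_of_pos_right (by omega) hB, ?_, ?_⟩
  · rw [hsub]
    exact dvd_mul_right _ _
  · rw [hsub]
    exact (Nat.mul_left_comm _ _ _).le

theorem IsPointOfOperation.n_pos {T LB LO : ℕ} {NB : Fin LB → ℕ} {NO : Fin LO → ℕ}
    {P : OperatingPoint LB} (hP : IsPointOfOperation T NB NO P) (hmB : ⨅ i, NB i ≤ T)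
    (hmO : ⨅ j, NO j ≤ T) : 0 < P.n := by
  cases hP with
  | initial => exact Nat.mul_pos (by omega) (by omega)
  | adjusted _ hn _ _ => exact hn

theorem IsPointOfOperation.isLinkParameter {T LB LO : ℕ} {NB : Fin LB → ℕ} {NO : Fin LO → ℕ}
    {P : OperatingPoint LB} (hP : IsPointOfOperation T NB NO P) (hmB : ⨅ i, NB i ≤ T)
    {i : Fin LB} (hN : 0 < NB i) (hT : NB i + ⨅ j, NO j ≤ T) :
    IsLinkParameter (T + 1 - ⨅ j, NO j) (NB i) P.n (P.k i) := by
  cases hP with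
  | initial => exact isLinkParameter_sub_mul hN (by omega) (by omega)
  | adjusted _ hn hrate hint =>
    refine isLinkParameter_of_rate_le hN hn (by omega) ?_ (hint i)
    rw [Nat.cast_sub (by omega)]
    exact_mod_cast hrate i

theorem allocate_invariant {T LB LO : ℕ} {NB : Fin LB → ℕ} {NO : Fin LO → ℕ}
    (hNB : ∀ i, 0 < NB i) (hNO : ∀ j, 0 < NO j) (hmB : ⨅ i, NB i ≤ T) (hmO : ⨅ j, NO j ≤ T)
    (hT : ∀ i, NB i + ⨅ j, NO j ≤ T) (hT' : ∀ j, NO j + ⨅ i, NB i ≤ T)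
    {P : OperatingPoint LB} (hP : IsPointOfOperation T NB NO P) {order : List (Fin LO)}
    (hnodup : order.Nodup) (hmem : ∀ j, j ∈ order) :
    AllocInvariant T (T - ⨅ i, NB i) (T + 1 - ⨅ j, NO j) NB NO Finset.univ
      (allocate T NB NO P order) := by
  have init : AllocInvariant T (T - ⨅ i, NB i) (T + 1 - ⨅ j, NO j) NB NO ∅ (allocInit T NB P) :=
    { n_pos := hP.n_pos hmB hmO
      bottleneck i := hP.isLinkParameter hmB (hNB i) (hT i)
      other i hi := absurd hi (Finset.notMem_empty i)
      con_nonneg d := by simp only [allocInit]; positivity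
      sum_le d := by simp only [allocInit, Finset.sum_empty, add_zero, le_refl] }
  rw [← Finset.eq_univ_of_forall fun j => List.mem_toFinset.2 (hmem j)]
  exact init.foldl hNO (fun j => Nat.le_sub_of_add_le (hT' j)) hnodup

/-! ### Matching the delays of the two hops -/

section Matching

variable {α β γ : Type*} [Fintype α] [Fintype β] [LinearOrder γ]

theorem exists_equiv_fin_monotone_comp (f : α → γ) :
    ∃ e : Fin (Fintype.card α) ≃ α, Monotone (f ∘ e) :=
  ⟨(Tuple.sort (f ∘ (Fintype.equivFin α).symm)).trans (Fintype.equivFin α).symm,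
    Tuple.monotone_sort (f ∘ (Fintype.equivFin α).symm)⟩

theorem symm_lt_card_filter_le_iff {f : α → γ} {m : ℕ} {e : Fin m ≃ α} (he : Monotone (f ∘ e))
    (a : α) (c : γ) :
    (e.symm a : ℕ) < (Finset.univ.filter fun x => f x ≤ c).card ↔ f a ≤ c := by
  have hcard : (Finset.univ.filter fun x => f x ≤ c).card =
      (Finset.univ.filter fun j => (f ∘ e) j ≤ c).card :=
    Finset.card_equiv e.symm fun x => by simp
  rw [hcard, Tuple.lt_card_le_iff_apply_le_of_monotone he, Function.comp_apply,
    e.apply_symm_apply]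

theorem exists_embedding_le_of_card_filter_le {f : α → γ} {g : β → γ}
    (h : ∀ a, (Finset.univ.filter fun x => f x ≤ f a).card ≤
      (Finset.univ.filter fun b => g b ≤ f a).card) :
    ∃ φ : α ↪ β, (∀ a, g (φ a) ≤ f a) ∧ ∀ b ∉ Set.range φ, ∀ a, g (φ a) ≤ g b := by
  obtain ⟨eα, hα⟩ := exists_equiv_fin_monotone_comp f
  obtain ⟨eβ, hβ⟩ := exists_equiv_fin_monotone_comp g
  have rank_lt (a : α) : (eα.symm a : ℕ) < (Finset.univ.filter fun b => g b ≤ f a).card :=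
    ((symm_lt_card_filter_le_iff hα a (f a)).2 le_rfl).trans_le (h a)
  have hcard : Fintype.card α ≤ Fintype.card β := by
    refine le_of_forall_lt fun j hj => ?_
    have := (rank_lt (eα ⟨j, hj⟩)).trans_le (Finset.card_le_univ _)
    rwa [eα.symm_apply_apply] at this
  let φ : α ↪ β := (eα.symm.toEmbedding.trans (Fin.castLEEmb hcard)).trans eβ.toEmbedding
  have rank_φ (a : α) : eβ.symm (φ a) = Fin.castLE hcard (eα.symm a) := eβ.symm_apply_apply _
  refine ⟨φ, fun a => ?_, fun b hb a => ?_⟩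
  · rw [← symm_lt_card_filter_le_iff hβ, rank_φ]
    exact rank_lt a
  · have rank_le : eβ.symm (φ a) ≤ eβ.symm b := by
      by_contra! hlt
      rw [rank_φ] at hlt
      refine hb ⟨eα ⟨eβ.symm b, (Fin.lt_def.1 hlt).trans (eα.symm a).isLt⟩, eβ.symm.injective ?_⟩
      rw [rank_φ, eα.symm_apply_apply]
      rfl
    simpa only [Function.comp_apply, Equiv.apply_symm_apply] using hβ rank_le

theorem exists_embedding_add_le_of_card_filter_le {f : α → ℕ} {g : β → ℕ} {T : ℕ}
    (hf : ∀ a, f a ≤ T)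
    (h : ∀ d, (Finset.univ.filter fun a => d ≤ f a).card ≤
      (Finset.univ.filter fun b => g b + d ≤ T).card) :
    ∃ φ : α ↪ β, (∀ a, g (φ a) + f a ≤ T) ∧ ∀ b ∉ Set.range φ, ∀ a, g (φ a) ≤ g b := by
  simp only [← Nat.le_sub_iff_add_le (hf _)]
  refine exists_embedding_le_of_card_filter_le fun a => ?_
  simp only [tsub_le_tsub_iff_left (hf a)]
  simpa only [Nat.le_sub_iff_add_le (hf a)] using h (f a)

end Matching

namespace LinkDesign

variable {F : Type*} [Field F] {M N n k : ℕ}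

theorem delay_lt (C : LinkDesign F N n k) (h : IsLinkParameter M N n k) (j : Fin k) :
    C.delay j < M := by
  by_contra! hle
  have := C.delay_card (C.delay j)
  rw [h.optimalSpectrum_eq_zero hle, Finset.card_eq_zero, Finset.filter_eq_empty_iff] at this
  exact this (Finset.mem_univ j) rfl

theorem card_filter_le_delay (C : LinkDesign F N n k) (h : IsLinkParameter M N n k) (d : ℕ) :
    (Finset.univ.filter fun j => d ≤ C.delay j).card =
      ∑ l ∈ Finset.Ico d M, optimalSpectrum N n k l := by
  simp only [← C.delay_card, Finset.sum_card_fiberwise_eq_card_filter, Finset.mem_Ico,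
    C.delay_lt h, and_true]

theorem sum_optimalSpectrum_sub_le (C : LinkDesign F N n k) {T E : ℕ} (hE : E ≤ T + 1) (d : ℕ) :
    ∑ l ∈ Finset.Ico d E, optimalSpectrum N n k (T - l) ≤
      (Finset.univ.filter fun j => C.delay j + d ≤ T).card := by
  have mirrored (l) (hl : l ∈ Finset.Ico d E) : optimalSpectrum N n k (T - l) =
      ((Finset.univ.filter fun j => C.delay j ≤ T).filter fun j => T - C.delay j = l).card := by
    have hl := Finset.mem_Ico.1 hl
    rw [← C.delay_card, Finset.filter_filter]
    refine congrArg Finset.card (Finset.filter_congr fun j _ => ?_)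
    omega
  rw [Finset.sum_congr rfl mirrored, Finset.sum_card_fiberwise_eq_card_filter,
    Finset.filter_filter]
  refine Finset.card_le_card (Finset.monotone_filter_right _ fun j _ hj => ?_)
  have := Finset.mem_Ico.1 hj.2
  omega

end LinkDesign

namespace HopDesign

variable {F : Type*} [Field F] {n k : ℕ}

theorem hopCode_achieves {L : ℕ} {N : Fin L → ℕ} {kl : Fin L → ℕ} (H : HopDesign F N n k kl) :
    H.hopCode.AchievesSpectrum N :=
  (PointToPointCode.AchievesSpectrum.separate H.achieves).place H.position

theorem schemeAchieves {T L₁ L₂ : ℕ} {N₁ : Fin L₁ → ℕ} {N₂ : Fin L₂ → ℕ} {k₁ : Fin L₁ → ℕ}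
    {k₂ : Fin L₂ → ℕ} (H₁ : HopDesign F N₁ n k k₁) (H₂ : HopDesign F N₂ n k k₂)
    (hT : ∀ j, H₁.symbolDelay j + H₂.symbolDelay j ≤ T) : SchemeAchieves F T N₁ N₂ n k k₁ k₂ :=
  ⟨H₁, H₂, hT, symbolwiseDF_isAchievable hT H₁.hopCode_achieves H₂.hopCode_achieves⟩

/-- The hop assembled from designs of its links and a placement of the source symbols. -/
def ofLinks {L : ℕ} {N : Fin L → ℕ} {kl : Fin L → ℕ} (C : ∀ i, LinkDesign F (N i) n (kl i))
    (position : Fin k ↪ Σ i, Fin (kl i))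
    (free_largest : ∀ x ∉ Set.range position, ∀ j,
      (C (position j).1).delay (position j).2 ≤ (C x.1).delay x.2) : HopDesign F N n k kl where
  delay i := (C i).delay
  code i := (C i).code
  position := position
  delay_card i := (C i).delay_card
  achieves i := (C i).achieves
  interleaved i := (C i).interleaved
  free_largest := free_largest

end HopDesign

namespace AllocInvariant

variable {F : Type*} [Field F] {T D M LB LO : ℕ} {NB : Fin LB → ℕ} {NO : Fin LO → ℕ}
  {S : AllocState LB LO}

theorem sum_Ico_optimalSpectrum_le (h : AllocInvariant T D M NB NO Finset.univ S) (d : ℕ) :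
    ∑ j, ∑ l ∈ Finset.Ico d (D + 1), optimalSpectrum (NO j) S.n (S.kO j) l ≤
      ∑ i, ∑ l ∈ Finset.Ico d (D + 1), optimalSpectrum (NB i) S.n (S.kB i) (T - l) := by
  have con_tail_nonneg : 0 ≤ ∑ l ∈ Finset.Ico d (D + 1), S.con l :=
    Finset.sum_nonneg fun l _ => h.con_nonneg l
  rw [Finset.sum_comm (s := Finset.univ (α := Fin LB))]
  zify
  linarith [h.sum_le d]

theorem card_filter_le_delay_le (h : AllocInvariant T D M NB NO Finset.univ S) (hDT : D ≤ T)
    (B : ∀ i, LinkDesign F (NB i) S.n (S.kB i)) (O : ∀ j, LinkDesign F (NO j) S.n (S.kO j))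
    (d : ℕ) :
    (Finset.univ.filter fun x : Σ j, Fin (S.kO j) => d ≤ (O x.1).delay x.2).card ≤
      (Finset.univ.filter fun x : Σ i, Fin (S.kB i) => (B x.1).delay x.2 + d ≤ T).card := by
  simp only [card_filter_sigma, (O _).card_filter_le_delay (h.other _ (Finset.mem_univ _))]
  exact (h.sum_Ico_optimalSpectrum_le d).trans
    (Finset.sum_le_sum fun i _ => (B i).sum_optimalSpectrum_sub_le (Nat.succ_le_succ hDT) d)

theorem exists_hopDesign (h : AllocInvariant T D M NB NO Finset.univ S) (hDT : D ≤ T)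
    (hM : (M : ℕ∞) ≤ ENat.card F) (hD : ((D + 1 : ℕ) : ℕ∞) ≤ ENat.card F) :
    ∃ (HB : HopDesign F NB S.n (∑ j, S.kO j) S.kB) (HO : HopDesign F NO S.n (∑ j, S.kO j) S.kO),
      ∀ j, HB.symbolDelay j + HO.symbolDelay j ≤ T := by
  obtain ⟨B⟩ := Classical.nonempty_pi.2 fun i => (h.bottleneck i).nonempty_linkDesign hM
  obtain ⟨O⟩ := Classical.nonempty_pi.2 fun j =>
    (h.other j (Finset.mem_univ j)).nonempty_linkDesign hD
  have delay_le (x : Σ j, Fin (S.kO j)) : (O x.1).delay x.2 ≤ T :=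
    (Nat.le_of_lt_succ ((O x.1).delay_lt (h.other x.1 (Finset.mem_univ _)) x.2)).trans hDT
  obtain ⟨φ, matched, free_largest⟩ := exists_embedding_add_le_of_card_filter_le
    (f := fun x : Σ j, Fin (S.kO j) => (O x.1).delay x.2)
    (g := fun x : Σ i, Fin (S.kB i) => (B x.1).delay x.2) delay_le
    (h.card_filter_le_delay_le hDT B O)
  let e : Fin (∑ j, S.kO j) ≃ Σ j, Fin (S.kO j) := finSigmaFinEquiv.symm
  refine ⟨.ofLinks B (e.toEmbedding.trans φ) fun x hx j => free_largest x ?_ (e j),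
    .ofLinks O e.toEmbedding fun x hx => absurd (e.surjective x) hx, fun j => ?_⟩
  · rintro ⟨a, rfl⟩
    exact hx ⟨e.symm a, congrArg φ (e.apply_symm_apply a)⟩
  · exact matched (e j)

end AllocInvariant

theorem exists_hopDesign_allocate {F : Type*} [Field F] {T LB LO : ℕ} {NB : Fin LB → ℕ}
    {NO : Fin LO → ℕ} (hNB : ∀ i, 0 < NB i) (hNO : ∀ j, 0 < NO j) (hmB : ⨅ i, NB i ≤ T)
    (hmO : ⨅ j, NO j ≤ T) (hT : ∀ i, NB i + ⨅ j, NO j ≤ T) (hT' : ∀ j, NO j + ⨅ i, NB i ≤ T)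
    (hF : ((T + 1 - min (⨅ i, NB i) (⨅ j, NO j) : ℕ) : ℕ∞) ≤ ENat.card F)
    {P : OperatingPoint LB} (hP : IsPointOfOperation T NB NO P) {order : List (Fin LO)}
    (hnodup : order.Nodup) (hmem : ∀ j, j ∈ order) :
    ∃ (HB : HopDesign F NB (allocate T NB NO P order).n (∑ j, (allocate T NB NO P order).kO j)
        (allocate T NB NO P order).kB)
      (HO : HopDesign F NO (allocate T NB NO P order).n (∑ j, (allocate T NB NO P order).kO j)
        (allocate T NB NO P order).kO),
      ∀ j, HB.symbolDelay j + HO.symbolDelay j ≤ T :=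
  (allocate_invariant hNB hNO hmB hmO hT hT' hP hnodup hmem).exists_hopDesign (Nat.sub_le _ _)
    ((Nat.cast_le.2 (by omega)).trans hF) ((Nat.cast_le.2 (by omega)).trans hF)

theorem iInf_pos_of_forall_pos {L : ℕ} (hL : 0 < L) {N : Fin L → ℕ} (hN : ∀ i, 0 < N i) :
    0 < ⨅ i, N i := by
  have := Fin.pos_iff_nonempty.1 hL
  obtain ⟨i, hi⟩ := ciInf_mem N
  exact hi ▸ hN i

end MultiLinkRelay

theorem mainTheorem1_general (F : Type*) [Field F] (T : ℕ) {L₁ L₂ : ℕ} (hL₁ : 0 < L₁)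
    (hL₂ : 0 < L₂) (N₁ : Fin L₁ → ℕ) (N₂ : Fin L₂ → ℕ) (hN₁ : ∀ i, 0 < N₁ i) (hN₂ : ∀ j, 0 < N₂ j)
    (hT₁ : ∀ i, N₁ i + ⨅ j, N₂ j ≤ T) (hT₂ : ∀ j, N₂ j + ⨅ i, N₁ i ≤ T)
    (hF : ((T + 1 - min (⨅ i, N₁ i) (⨅ j, N₂ j) : ℕ) : ℕ∞) ≤ ENat.card F) :
    (∀ (P : MultiLinkRelay.OperatingPoint L₁) (order : List (Fin L₂)),
      MultiLinkRelay.IsPointOfOperation T N₁ N₂ P →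
      order.Nodup → (∀ j, j ∈ order) →
      MultiLinkRelay.SchemeAchieves F T N₁ N₂
        (MultiLinkRelay.allocate T N₁ N₂ P order).n
        (∑ j, (MultiLinkRelay.allocate T N₁ N₂ P order).kO j)
        (MultiLinkRelay.allocate T N₁ N₂ P order).kB
        (MultiLinkRelay.allocate T N₁ N₂ P order).kO) ∧
    (∀ (P : MultiLinkRelay.OperatingPoint L₂) (order : List (Fin L₁)),
      MultiLinkRelay.IsPointOfOperation T N₂ N₁ P →
      order.Nodup → (∀ i, i ∈ order) →
      MultiLinkRelay.SchemeAchieves F T N₁ N₂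
        (MultiLinkRelay.allocate T N₂ N₁ P order).n
        (∑ i, (MultiLinkRelay.allocate T N₂ N₁ P order).kO i)
        (MultiLinkRelay.allocate T N₂ N₁ P order).kO
        (MultiLinkRelay.allocate T N₂ N₁ P order).kB) := by
  have inf_N₁_le : ⨅ i, N₁ i ≤ T := (Nat.le_add_left _ _).trans (hT₂ ⟨0, hL₂⟩)
  have inf_N₂_le : ⨅ j, N₂ j ≤ T := (Nat.le_add_left _ _).trans (hT₁ ⟨0, hL₁⟩)
  refine ⟨fun P order hP hnodup hmem => ?_, fun P order hP hnodup hmem => ?_⟩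
  · obtain ⟨H₁, H₂, hT⟩ := MultiLinkRelay.exists_hopDesign_allocate hN₁ hN₂ inf_N₁_le inf_N₂_le
      hT₁ hT₂ hF hP hnodup hmem
    exact H₁.schemeAchieves H₂ hT
  · obtain ⟨H₂, H₁, hT⟩ := MultiLinkRelay.exists_hopDesign_allocate hN₂ hN₁ inf_N₂_le inf_N₁_le
      hT₂ hT₁ (min_comm (⨅ i, N₁ i) _ ▸ hF) hP hnodup hmem
    exact H₁.schemeAchieves H₂ fun j => (Nat.add_comm _ _).trans_le (hT j)

theorem mainTheorem1 (F : Type*) [Field F] (T : ℕ) {L₁ L₂ : ℕ} (hL₁ : 0 < L₁) (hL₂ : 0 < L₂)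
    (N₁ : Fin L₁ → ℕ) (N₂ : Fin L₂ → ℕ) (hN₁ : ∀ i, 0 < N₁ i) (hN₂ : ∀ j, 0 < N₂ j)
    (hT₁ : ∀ i, N₁ i + ⨅ j, N₂ j ≤ T) (hT₂ : ∀ j, N₂ j + ⨅ i, N₁ i ≤ T)
    (hF : (T : ℕ∞) ≤ ENat.card F) :
    (∀ (P : MultiLinkRelay.OperatingPoint L₁) (order : List (Fin L₂)),
      MultiLinkRelay.IsPointOfOperation T N₁ N₂ P →
      MultiLinkRelay.IsDecreasingOrder N₂ order →
      MultiLinkRelay.SchemeAchieves F T N₁ N₂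
        (MultiLinkRelay.allocate T N₁ N₂ P order).n
        (∑ j, (MultiLinkRelay.allocate T N₁ N₂ P order).kO j)
        (MultiLinkRelay.allocate T N₁ N₂ P order).kB
        (MultiLinkRelay.allocate T N₁ N₂ P order).kO) ∧
    (∀ (P : MultiLinkRelay.OperatingPoint L₂) (order : List (Fin L₁)),
      MultiLinkRelay.IsPointOfOperation T N₂ N₁ P →
      MultiLinkRelay.IsDecreasingOrder N₁ order →
      MultiLinkRelay.SchemeAchieves F T N₁ N₂
        (MultiLinkRelay.allocate T N₂ N₁ P order).n
        (∑ i, (MultiLinkRelay.allocate T N₂ N₁ P order).kO i)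
        (MultiLinkRelay.allocate T N₂ N₁ P order).kO
        (MultiLinkRelay.allocate T N₂ N₁ P order).kB) := by
  have inf_pos := lt_min (MultiLinkRelay.iInf_pos_of_forall_pos hL₁ hN₁)
    (MultiLinkRelay.iInf_pos_of_forall_pos hL₂ hN₂)
  exact (mainTheorem1_general F T hL₁ hL₂ N₁ N₂ hN₁ hN₂ hT₁ hT₂
    ((Nat.cast_le.2 (by omega)).trans hF)).imp
      (fun h P order hP horder => h P order hP horder.1 horder.2.1)
      (fun h P order hP horder => h P order hP horder.1 horder.2.1)
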